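/- A seminormed nonnegative cone in a Banach space $B$ is a set $M\subset B$ with $cu\in M$ for all $u\in M$, $c\ge 0$, together with a function $[\cdot]:M\to[0,\infty)$ such that $[u]=0$ if and only if $u=0$, and $[cu]=c[u]$ for all $u\in M$, $c\ge 0$. It is continuously embedded in $B$ if $\|u\|_B\le C[u]$ on $M$ for some $C>0$, and compactly embedded in $B$ if every sequence in $M$ with bounded $[\cdot]$ is relatively compact in $B$. Proposition (Discrete Aubin–Lions–Dubinskiĭ). Let $B$ and $Y_n$ $(n\in\mathbb N)$ be Banach spaces, all of them linear subspaces of one vector space (no continuity of embeddings between $B$ and $Y_n$ is assumed), and let $M_n$ be seminormed nonnegative cones in $B$ with functions $[\cdot]_n$, each continuously embedded in $B$. Assume: (a) if $w_n\in M_n$ for all $n$ and $\sup_n[w_n]_n<\infty$, then $(w_n)$ is relatively compact in $B$; (b) for all indices $n_1<n_2<\cdots$ and all $x_k,y_k\in M_{n_k}\cap Y_{n_k}$: if $x_k-y_k\to w$ in $B$ and $\|x_k-y_k\|_{Y_{n_k}}\to 0$ as $k\to\infty$, then $w=0$. Let $1\le p\le\infty$, $T>0$, and let $u_n\in L^p(0,T;M_n\cap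 Y_n)$, that is, $u_n$ is strongly measurable in $B$ and in $Y_n$, $u_n(t)\in M_n\cap Y_n$ for a.e. $t\in(0,T)$, and $t\mapsto[u_n(t)]_n$ belongs to $L^p(0,T)$. Suppose that (i) there exists $C>0$ such that $\|u_n\|_{L^p(0,T;M_n)}:=\big\|[u_n(\cdot)]_n\big\|_{L^p(0,T)}\le C$ for all $n$; (ii) $\|u_n(\cdot+h)-u_n\|_{L^p(0,T-h;Y_n)}\to 0$ as $h\to 0^+$, uniformly in $n$. Then $(u_n)$ is relatively compact in $L^p(0,T;B)$. If $p=\infty$ and, in addition, for each fixed $n$, $M_n$ is compactly embedded in $B$ and condition (b) holds with $n_k=n$ for all $k$, then each $u_n$ agrees almost everywhere with a function in $C([0,T];B)$, and $(u_n)$ is relatively compact in $C([0,T];B)$. -/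

import Mathlib

open MeasureTheory Filter Topology Set
open scoped ENNReal NNReal

/-- A seminormed nonnegative cone in a Banach space `B`: a set closed under multiplication by
nonnegative reals, with a positively homogeneous, definite function `[·]` on it. No additivity of
the set and no triangle inequality are required. Values of `semi` outside the cone are irrelevant. -/
structure SeminormedCone (B : Type*) [NormedAddCommGroup B] [NormedSpace ℝ B] where
  carrier : Set B
  semi : B → ℝ
  smul_mem : ∀ u ∈ carrier, ∀ c : ℝ, 0 ≤ c → c • u ∈ carrier
  semi_nonneg : ∀ u ∈ carrier, 0 ≤ semi u
  semi_eq_zero_iff : ∀ u ∈ carrier, (semi u = 0 ↔ u = 0)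
  semi_smul : ∀ u ∈ carrier, ∀ c : ℝ, 0 ≤ c → semi (c • u) = c * semi u

section

variable {B : Type*} [NormedAddCommGroup B] [NormedSpace ℝ B]

/-- `M ↪ B` continuously. -/
def SeminormedCone.ContinuouslyEmbedded (M : SeminormedCone B) : Prop :=
  ∃ C : ℝ, 0 < C ∧ ∀ u ∈ M.carrier, ‖u‖ ≤ C * M.semi u

/-- Compactness along the sequence of cones `M (ν 0), M (ν 1), …`: whenever `w k ∈ M (ν k)` has
bounded seminorms `[w k]`, the sequence `w` is relatively compact in `B`.
For a constant `ν` with value `n` this says that `M n ↪ B` compactly. -/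
def CompactAlong (M : ℕ → SeminormedCone B) (ν : ℕ → ℕ) : Prop :=
  ∀ w : ℕ → B, (∀ k, w k ∈ (M (ν k)).carrier) →
    (∃ C : ℝ, ∀ k, (M (ν k)).semi (w k) ≤ C) → IsCompact (closure (range w))

variable {E : Type*} [AddCommGroup E] [Module ℝ E]

section

variable {Y : Type*} [NormedAddCommGroup Y] [NormedSpace ℝ Y]

/-- `B` and `Y` are regarded as linear subspaces of a vector space `E` through `ι` and `j`;
`InSpace ι j x` says that the element `x` of `B` belongs to `Y`. -/
def InSpace (ι : B →ₗ[ℝ] E) (j : Y →ₗ[ℝ] E) (x : B) : Prop := ∃ y : Y, j y = ι x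

/-- The norm in `Y` of an element `x` of `B`; it is `∞` if `x` does not belong to `Y`. -/
noncomputable def normIn (ι : B →ₗ[ℝ] E) (j : Y →ₗ[ℝ] E) (x : B) : ℝ≥0∞ :=
  ⨅ (y : Y) (_ : j y = ι x), ‖y‖ₑ

/-- If `j` is injective and `x` is the element `y` of `Y`, then `normIn` is the norm of `y`. -/
theorem normIn_eq (ι : B →ₗ[ℝ] E) (j : Y →ₗ[ℝ] E) (hj : Function.Injective j) {x : B} {y : Y}
    (h : j y = ι x) : normIn ι j x = ‖y‖ₑ := by
  refine le_antisymm (iInf₂_le y h) (le_iInf₂ fun z hz => ?_)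
  rw [hj (hz.trans h.symm)]

/-- `u ∈ L^p(0,T; M ∩ Y)`: `u` is strongly measurable in `B` and in `Y`, takes values in `M ∩ Y`
almost everywhere on `(0,T)`, and `t ↦ [u(t)]` belongs to `L^p(0,T)`.
(Integrability of the norm of `u` in `Y` is not demanded.) -/
structure MemLpCone (M : SeminormedCone B) (ι : B →ₗ[ℝ] E) (j : Y →ₗ[ℝ] E)
    (p : ℝ≥0∞) (T : ℝ) (u : ℝ → B) : Prop where
  aestronglyMeasurable : AEStronglyMeasurable u (volume.restrict (Ioo 0 T))
  mem_cone : ∀ᵐ t ∂(volume.restrict (Ioo 0 T)), u t ∈ M.carrier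
  memLp_semi : MemLp (fun t => M.semi (u t)) p (volume.restrict (Ioo 0 T))
  measurable_in : ∃ v : ℝ → Y, AEStronglyMeasurable v (volume.restrict (Ioo 0 T)) ∧
    ∀ᵐ t ∂(volume.restrict (Ioo 0 T)), j (v t) = ι (u t)

/-- `‖σ_h u - u‖` in `L^p(0,T-h; Y)`, where `(σ_h u)(t) = u(t+h)`. -/
noncomputable def shiftNorm (ι : B →ₗ[ℝ] E) (j : Y →ₗ[ℝ] E) (p : ℝ≥0∞) (T : ℝ) (u : ℝ → B)
    (h : ℝ) : ℝ≥0∞ :=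
  eLpNorm (fun t => normIn ι j (u (t + h) - u t)) p (volume.restrict (Ioo 0 (T - h)))

end

/-- Compatibility along the sequence of pairs `(M (ν k), Y (ν k))`: if `w k` are differences of
elements of `M (ν k) ∩ Y (ν k)`, `w k → w` in `B`, and the norms of `w k` in `Y (ν k)` tend to
zero, then `w = 0`. -/
def CompatibleAlong (M : ℕ → SeminormedCone B) {Y : ℕ → Type*}
    [∀ n, NormedAddCommGroup (Y n)] [∀ n, NormedSpace ℝ (Y n)]
    (ι : B →ₗ[ℝ] E) (j : ∀ n, Y n →ₗ[ℝ] E) (ν : ℕ → ℕ) : Prop :=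
  ∀ (x y : ℕ → B) (w : B),
    (∀ k, x k ∈ (M (ν k)).carrier ∧ InSpace ι (j (ν k)) (x k)) →
    (∀ k, y k ∈ (M (ν k)).carrier ∧ InSpace ι (j (ν k)) (y k)) →
    Tendsto (fun k => x k - y k) atTop (𝓝 w) →
    Tendsto (fun k => normIn ι (j (ν k)) (x k - y k)) atTop (𝓝 0) → w = 0

end

/-! The heart is an Ehrling inequality for differences: for each ε there is C such that, for all
large n, ‖x - y‖ ≤ ε([x] + [y]) + C‖x - y‖_Y whenever x, y ∈ M_n ∩ Y_n
(`exists_ehrlingWith_eventually`). Differences leave the cone, so x and y are rescaled together by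
[x] + [y] and compactness is applied to each separately. Applied to x = u_n(t + h), y = u_n(t), the
inequality turns small translates in Y_n into small translates in B, uniformly for large n
(`exists_shift_le`).

The usual time averages are unavailable, since a cone need not be convex. Instead u_n is sampled: in
each of K cells of (0,T) a time s_k is chosen, by a mean value argument, such that [u_n(s_k)] is
bounded independently of n and the resulting step function is close to u_n in L^p
(`exists_samples`). By (a) the sample vectors are relatively compact in B^K, which yields finite
nets in L^p; finitely many early terms do no harm (`isCompact_closure_range_toLp`).

For p = ∞, Ehrling's inequality for each single n makes every u_n essentially uniformly continuous
(`exists_continuous_representative`), and sup distances are bounded by L^∞ distances, so the nets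
carry over to C([0,T];B). -/

/-- A sequence is covered by finitely many balls around its members if closeness of its late terms
is controlled by a totally bounded sequence. -/
theorem exists_finite_net_of_totallyBounded {X Z : Type*} [PseudoMetricSpace X]
    [PseudoMetricSpace Z] (x : ℕ → X) (a : ℕ → Z) (ha : TotallyBounded (range a)) {ε δ : ℝ}
    (hε : 0 < ε) (hδ : 0 < δ) (N : ℕ)
    (h : ∀ n m, N ≤ n → N ≤ m → dist (a n) (a m) < δ → dist (x n) (x m) < ε) :
    ∃ t : Set X, t.Finite ∧ range x ⊆ ⋃ y ∈ t, Metric.ball y ε := by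
  obtain ⟨t, htN, htf, hcov⟩ := exists_subset_image_finite_and.1
    (Metric.finite_approx_of_totallyBounded (ha.subset (image_subset_range a (Ici N))) δ hδ)
  refine ⟨x '' (t ∪ Iio N), (htf.union (finite_Iio N)).image x, ?_⟩
  rintro _ ⟨n, rfl⟩
  rw [biUnion_image, mem_iUnion₂]
  rcases lt_or_ge n N with hn | hn
  · exact ⟨n, Or.inr hn, Metric.mem_ball_self hε⟩
  · have := hcov ⟨n, hn, rfl⟩
    rw [biUnion_image, mem_iUnion₂] at this
    obtain ⟨m, hm, hd⟩ := this
    exact ⟨m, Or.inl hm, h n m hn (htN hm) hd⟩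

theorem isCompact_closure_range_of_net {X : Type*} [MetricSpace X] [CompleteSpace X] {x : ℕ → X}
    (h : ∀ ε > 0, ∃ t : Set X, t.Finite ∧ range x ⊆ ⋃ y ∈ t, Metric.ball y ε) :
    IsCompact (closure (range x)) :=
  isCompact_iff_totallyBounded_isComplete.2
    ⟨(Metric.totallyBounded_iff.2 h).closure, isClosed_closure.isComplete⟩

/-! ### Ehrling's inequality on cones -/

section

variable {B : Type*} [NormedAddCommGroup B] [NormedSpace ℝ B]

theorem SeminormedCone.zero_mem (M : SeminormedCone B) (h : M.carrier.Nonempty) :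
    (0 : B) ∈ M.carrier := by
  obtain ⟨x, hx⟩ := h
  simpa using M.smul_mem x hx 0 le_rfl

theorem SeminormedCone.semi_zero (M : SeminormedCone B) (h : M.carrier.Nonempty) :
    M.semi 0 = 0 :=
  (M.semi_eq_zero_iff 0 (M.zero_mem h)).2 rfl

/-- Compactness along all indices passes to subsequences. -/
theorem CompactAlong.comp_strictMono {M : ℕ → SeminormedCone B} (h : CompactAlong M id)
    (hne : ∀ n, (M n).carrier.Nonempty) {ν : ℕ → ℕ} (hν : StrictMono ν) : CompactAlong M ν := by
  classical
  rintro w hw ⟨C, hC⟩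
  -- Skipped indices are filled with 0, which lies in every nonempty cone and has seminorm 0.
  let w' : ℕ → B := fun n => if hn : ∃ k, ν k = n then w hn.choose else 0
  have hw' : ∀ k, w' (ν k) = w k := by
    intro k
    have hk : ∃ l, ν l = ν k := ⟨k, rfl⟩
    have : hk.choose = k := hν.injective hk.choose_spec
    simp only [w', dif_pos hk, this]
  have hcpt : IsCompact (closure (range w')) := by
    refine h w' (fun n => ?_) ⟨max C 0, fun n => ?_⟩
    · by_cases hn : ∃ k, ν k = n
      · obtain ⟨k, rfl⟩ := hn
        simpa [hw'] using hw k
      · simpa only [id, w', dif_neg hn] using (M n).zero_mem (hne n)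
    · by_cases hn : ∃ k, ν k = n
      · obtain ⟨k, rfl⟩ := hn
        simpa only [id, hw'] using (hC k).trans (le_max_left _ _)
      · simp only [id, w', dif_neg hn, (M n).semi_zero (hne n), le_max_right]
  refine hcpt.of_isClosed_subset isClosed_closure (closure_mono ?_)
  rintro _ ⟨k, rfl⟩
  exact ⟨ν k, hw' k⟩

variable {E : Type*} [AddCommGroup E] [Module ℝ E]
  {Y : ℕ → Type*} [∀ n, NormedAddCommGroup (Y n)] [∀ n, NormedSpace ℝ (Y n)]

/-- Dividing by [x] + [y] makes both sequences bounded in the cones, so subsequences converge in B;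
the factor k forces the Y-norms of the differences to 0, so compatibility makes the limit difference
vanish, although its norm is at least ε. Leaving `ν` arbitrary covers both varying and constant
indices. -/
theorem not_forall_lt_norm_sub (M : ℕ → SeminormedCone B) (ι : B →ₗ[ℝ] E)
    (j : ∀ n, Y n →ₗ[ℝ] E) (hj : ∀ n, Function.Injective (j n)) (ν : ℕ → ℕ)
    (hcompact : CompactAlong M ν)
    (hcompat : ∀ φ : ℕ → ℕ, StrictMono φ → CompatibleAlong M ι j (ν ∘ φ))
    {ε : ℝ} (hε : 0 < ε) (x y : ℕ → B) (a b : ∀ k, Y (ν k))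
    (hx : ∀ k, x k ∈ (M (ν k)).carrier) (hy : ∀ k, y k ∈ (M (ν k)).carrier)
    (ha : ∀ k, j (ν k) (a k) = ι (x k)) (hb : ∀ k, j (ν k) (b k) = ι (y k)) :
    ¬ ∀ k : ℕ, ε * ((M (ν k)).semi (x k) + (M (ν k)).semi (y k)) + k * ‖a k - b k‖
      < ‖x k - y k‖ := by
  intro hlt
  set S : ℕ → ℝ := fun k => (M (ν k)).semi (x k) + (M (ν k)).semi (y k) with hS
  have hx0 := fun k => (M (ν k)).semi_nonneg _ (hx k)
  have hy0 := fun k => (M (ν k)).semi_nonneg _ (hy k)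
  -- If the sum vanished, definiteness would give x = y = 0, against the strict inequality.
  have hSpos : ∀ k, 0 < S k := by
    intro k
    refine lt_of_le_of_ne (add_nonneg (hx0 k) (hy0 k)) fun h0 => ?_
    have h1 : (M (ν k)).semi (x k) = 0 := by simp only [hS] at h0; linarith [hx0 k, hy0 k]
    have h2 : (M (ν k)).semi (y k) = 0 := by simp only [hS] at h0; linarith [hx0 k, hy0 k]
    have h3 := ((M (ν k)).semi_eq_zero_iff _ (hx k)).1 h1
    have h4 := ((M (ν k)).semi_eq_zero_iff _ (hy k)).1 h2
    have h5 := hlt k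
    rw [h1, h2, h3, h4] at h5
    have : 0 ≤ (k : ℝ) * ‖a k - b k‖ := by positivity
    simp at h5
    linarith
  have hc : ∀ k, 0 ≤ (S k)⁻¹ := fun k => (inv_pos.2 (hSpos k)).le
  have hX : ∀ k, (S k)⁻¹ • x k ∈ (M (ν k)).carrier := fun k => (M _).smul_mem _ (hx k) _ (hc k)
  have hY : ∀ k, (S k)⁻¹ • y k ∈ (M (ν k)).carrier := fun k => (M _).smul_mem _ (hy k) _ (hc k)
  have hXc := hcompact (fun k => (S k)⁻¹ • x k) hX ⟨1, fun k => by
    rw [(M _).semi_smul _ (hx k) _ (hc k), inv_mul_le_iff₀ (hSpos k)]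
    simp only [hS]; linarith [hy0 k]⟩
  have hYc := hcompact (fun k => (S k)⁻¹ • y k) hY ⟨1, fun k => by
    rw [(M _).semi_smul _ (hy k) _ (hc k), inv_mul_le_iff₀ (hSpos k)]
    simp only [hS]; linarith [hx0 k]⟩
  obtain ⟨x₀, -, φ₁, hφ₁, hlim₁⟩ := hXc.tendsto_subseq fun k => subset_closure (mem_range_self k)
  obtain ⟨y₀, -, φ₂, hφ₂, hlim₂⟩ :=
    hYc.tendsto_subseq fun k => subset_closure (mem_range_self (φ₁ k))
  set φ := φ₁ ∘ φ₂ with hφdef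
  have hφ : StrictMono φ := hφ₁.comp hφ₂
  have hlim : Tendsto (fun k => (S (φ k))⁻¹ • x (φ k) - (S (φ k))⁻¹ • y (φ k)) atTop
      (𝓝 (x₀ - y₀)) := (hlim₁.comp hφ₂.tendsto_atTop).sub hlim₂
  have hlow : ∀ k, ε + φ k * ‖(S (φ k))⁻¹ • (a (φ k) - b (φ k))‖
      ≤ ‖(S (φ k))⁻¹ • x (φ k) - (S (φ k))⁻¹ • y (φ k)‖ := by
    intro k
    rw [← smul_sub, norm_smul, norm_smul, Real.norm_of_nonneg (hc _)]
    have h1 := mul_le_mul_of_nonneg_left (hlt (φ k)).le (hc (φ k))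
    have h2 : (S (φ k))⁻¹ * S (φ k) = 1 := inv_mul_cancel₀ (hSpos _).ne'
    calc _ = (S (φ k))⁻¹ * (ε * S (φ k) + φ k * ‖a (φ k) - b (φ k)‖) := by
          linear_combination -ε * h2
      _ ≤ _ := h1
  obtain ⟨D, hD⟩ := hlim.norm.bddAbove_range
  have hsmall : Tendsto (fun k => ‖(S (φ k))⁻¹ • (a (φ k) - b (φ k))‖) atTop (𝓝 0) := by
    have hcast : Tendsto (fun k => (φ k : ℝ)) atTop atTop :=
      tendsto_natCast_atTop_atTop.comp hφ.tendsto_atTop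
    refine squeeze_zero' (Eventually.of_forall fun k => norm_nonneg _) ?_
      (hcast.const_div_atTop D)
    filter_upwards [hcast.eventually_gt_atTop 0] with k hk
    rw [le_div_iff₀ hk]
    have h1 : _ ≤ D := hD (mem_range_self k)
    linarith [hlow k]
  have hzero : x₀ - y₀ = 0 := by
    refine hcompat φ hφ (fun k => (S (φ k))⁻¹ • x (φ k)) (fun k => (S (φ k))⁻¹ • y (φ k)) _
      (fun k => ⟨hX _, (S (φ k))⁻¹ • a (φ k), by rw [map_smul, map_smul]; exact congrArg _ (ha _)⟩)
      (fun k => ⟨hY _, (S (φ k))⁻¹ • b (φ k), by rw [map_smul, map_smul]; exact congrArg _ (hb _)⟩) hlim ?_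
    have hn : ∀ k, normIn ι (j ((ν ∘ φ) k)) ((S (φ k))⁻¹ • x (φ k) - (S (φ k))⁻¹ • y (φ k))
        = ENNReal.ofReal ‖(S (φ k))⁻¹ • (a (φ k) - b (φ k))‖ := by
      intro k
      rw [ofReal_norm]
      exact normIn_eq _ _ (hj _) (by
        rw [← smul_sub, map_smul, map_smul, map_sub, map_sub]
        exact congrArg _ (congrArg₂ _ (ha _) (hb _)))
    simp_rw [hn]
    simpa using ENNReal.tendsto_ofReal hsmall
  have hge : ε ≤ ‖x₀ - y₀‖ := ge_of_tendsto' hlim.norm fun k =>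
    le_trans (by have : 0 ≤ (φ k : ℝ) * ‖(S (φ k))⁻¹ • (a (φ k) - b (φ k))‖ := by positivity
                 linarith) (hlow k)
  rw [hzero, norm_zero] at hge
  linarith

/-- Ehrling's inequality for differences of elements of a single cone. -/
def EhrlingWith (M : SeminormedCone B) {Y : Type*} [NormedAddCommGroup Y] [NormedSpace ℝ Y]
    (ι : B →ₗ[ℝ] E) (j : Y →ₗ[ℝ] E) (ε C : ℝ) : Prop :=
  ∀ x ∈ M.carrier, ∀ y ∈ M.carrier, ∀ a b : Y, j a = ι x → j b = ι y →
    ‖x - y‖ ≤ ε * (M.semi x + M.semi y) + C * ‖a - b‖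

/-- If every constant k fails for infinitely many n, a diagonal choice gives strictly increasing
indices at which the k-th constant fails. -/
theorem exists_ehrlingWith_eventually (M : ℕ → SeminormedCone B) (ι : B →ₗ[ℝ] E)
    (j : ∀ n, Y n →ₗ[ℝ] E) (hj : ∀ n, Function.Injective (j n))
    (hcompact : ∀ ν : ℕ → ℕ, StrictMono ν → CompactAlong M ν)
    (hcompat : ∀ ν : ℕ → ℕ, StrictMono ν → CompatibleAlong M ι j ν) {ε : ℝ} (hε : 0 < ε) :
    ∃ C : ℝ, 0 ≤ C ∧ ∀ᶠ n in atTop, EhrlingWith (M n) ι (j n) ε C := by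
  by_contra! hcon
  obtain ⟨ν, hν, h⟩ := extraction_forall_of_frequently
    (P := fun k n => ¬ EhrlingWith (M n) ι (j n) ε k) fun k => hcon k (Nat.cast_nonneg k)
  simp only [EhrlingWith, not_forall, not_le] at h
  choose x hx y hy a b ha hb hlt using h
  exact not_forall_lt_norm_sub M ι j hj ν (hcompact ν hν)
    (fun φ hφ => hcompat _ (hν.comp hφ)) hε x y a b hx hy ha hb hlt

theorem exists_ehrlingWith (M : ℕ → SeminormedCone B) (ι : B →ₗ[ℝ] E)
    (j : ∀ n, Y n →ₗ[ℝ] E) (hj : ∀ n, Function.Injective (j n)) (n : ℕ)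
    (hcompact : CompactAlong M fun _ => n) (hcompat : CompatibleAlong M ι j fun _ => n)
    {ε : ℝ} (hε : 0 < ε) : ∃ C : ℝ, 0 ≤ C ∧ EhrlingWith (M n) ι (j n) ε C := by
  by_contra! hcon
  have h := fun k : ℕ => hcon k (Nat.cast_nonneg k)
  simp only [EhrlingWith, not_forall, not_le] at h
  choose x hx y hy a b ha hb hlt using h
  exact not_forall_lt_norm_sub M ι j hj (fun _ => n) hcompact
    (fun φ _ => hcompat) hε x y a b hx hy ha hb hlt

end

/-! ### Oscillation near the diagonal -/

theorem measurableSet_near_diagonal (h : ℝ) :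
    MeasurableSet {z : ℝ × ℝ | z.2 ∈ Ioo (z.1 - h) (z.1 + h)} :=
  (measurableSet_lt (f := fun z : ℝ × ℝ => z.1 - h) (g := fun z => z.2)
    (by fun_prop) (by fun_prop)).inter
  (measurableSet_lt (f := fun z : ℝ × ℝ => z.2) (g := fun z => z.1 + h) (by fun_prop) (by fun_prop))

theorem measurable_lintegral_near_diagonal {T h : ℝ} {f : ℝ → ℝ → ℝ≥0∞}
    (hf : Measurable (Function.uncurry f)) :
    Measurable fun s => ∫⁻ t in Ioo 0 T ∩ Ioo (s - h) (s + h), f s t := by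
  have : ∀ s, ∫⁻ t in Ioo 0 T ∩ Ioo (s - h) (s + h), f s t =
      ∫⁻ t, ({z : ℝ × ℝ | z.2 ∈ Ioo 0 T ∧ z.2 ∈ Ioo (z.1 - h) (z.1 + h)}.indicator
        (Function.uncurry f)) (s, t) := by
    intro s
    rw [← lintegral_indicator (measurableSet_Ioo.inter measurableSet_Ioo)]
    rfl
  simp_rw [this]
  exact Measurable.lintegral_prod_right' (hf.indicator
    ((measurable_snd measurableSet_Ioo).inter (measurableSet_near_diagonal h)))

/-- Integrals over a neighbourhood of the diagonal are controlled by integrals over its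
translates. -/
theorem lintegral_near_diagonal_le {T h : ℝ} {ω : ℝ≥0∞} {f : ℝ → ℝ → ℝ≥0∞}
    (hf : Measurable (Function.uncurry f)) (hsymm : ∀ s t, f s t = f t s) (hdiag : ∀ s, f s s = 0)
    (hω : ∀ r ∈ Ioo 0 h, ∫⁻ s in Ioo 0 (T - r), f s (s + r) ≤ ω) :
    ∫⁻ s in Ioo 0 T, ∫⁻ t in Ioo 0 T ∩ Ioo (s - h) (s + h), f s t
      ≤ ENNReal.ofReal (2 * h) * ω := by
  set D : Set (ℝ × ℝ) := {z | z.1 ∈ Ioo 0 T ∧ z.2 ∈ Ioo 0 T ∧ z.2 ∈ Ioo (z.1 - h) (z.1 + h)}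
  have hD : MeasurableSet D := (measurable_fst measurableSet_Ioo).inter
    ((measurable_snd measurableSet_Ioo).inter (measurableSet_near_diagonal h))
  set g : ℝ × ℝ → ℝ≥0∞ := D.indicator (Function.uncurry f)
  have hg : Measurable g := hf.indicator hD
  -- Slices parallel to the diagonal: r < 0 reduces to -r by symmetry, and r = 0, where no translate
  -- bound is given, contributes nothing because f vanishes on the diagonal.
  have hslice : ∀ r, ∫⁻ s, g (s, s + r) ≤ (Ioo (-h) h).indicator (fun _ => ω) r := by
    intro r
    by_cases hr : r ∈ Ioo (-h) h
    · rw [indicator_of_mem hr]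
      rcases lt_trichotomy r 0 with h0 | h0 | h0
      · rw [← lintegral_add_right_eq_self _ (-r)]
        refine le_trans ?_ (hω (-r) ⟨by linarith, by linarith [hr.1]⟩)
        rw [← lintegral_indicator measurableSet_Ioo]
        refine lintegral_mono fun s => ?_
        by_cases hs : (s + -r, s + -r + r) ∈ D
        · have hs' : s ∈ Ioo 0 (T - -r) := by
            obtain ⟨h1, h2, -⟩ := hs
            simp only [mem_Ioo] at h1 h2 ⊢
            constructor <;> linarith
          simp only [g, indicator_of_mem hs, indicator_of_mem hs', Function.uncurry_apply_pair]
          rw [hsymm, neg_add_cancel_right]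
        · simp only [g, indicator_of_notMem hs, zero_le]
      · subst h0
        refine le_trans (le_of_eq ?_) bot_le
        refine (lintegral_congr fun s => ?_).trans lintegral_zero
        simp [g, indicator_apply, hdiag]
      · refine le_trans ?_ (hω r ⟨h0, hr.2⟩)
        rw [← lintegral_indicator measurableSet_Ioo]
        refine lintegral_mono fun s => ?_
        by_cases hs : (s, s + r) ∈ D
        · have hs' : s ∈ Ioo 0 (T - r) := by
            obtain ⟨h1, h2, -⟩ := hs
            simp only [mem_Ioo] at h1 h2 ⊢
            constructor <;> linarith
          simp only [g, indicator_of_mem hs, indicator_of_mem hs', Function.uncurry_apply_pair,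
            le_refl]
        · simp [g, indicator_of_notMem hs]
    · rw [indicator_of_notMem hr]
      refine le_of_eq ((lintegral_congr fun s => ?_).trans lintegral_zero)
      refine indicator_of_notMem (fun hs => hr ?_) _
      have h3 := hs.2.2
      simp only [mem_Ioo] at h3 ⊢
      constructor <;> linarith
  calc ∫⁻ s in Ioo 0 T, ∫⁻ t in Ioo 0 T ∩ Ioo (s - h) (s + h), f s t
      = ∫⁻ s, ∫⁻ t, g (s, t) := by
        rw [← lintegral_indicator measurableSet_Ioo]
        refine lintegral_congr fun s => ?_
        by_cases hs : s ∈ Ioo 0 T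
        · rw [indicator_of_mem hs,
            ← lintegral_indicator (measurableSet_Ioo.inter measurableSet_Ioo)]
          refine lintegral_congr fun t => ?_
          by_cases ht : t ∈ Ioo 0 T ∩ Ioo (s - h) (s + h)
          · rw [indicator_of_mem ht]
            exact (indicator_of_mem (s := D) (a := (s, t)) ⟨hs, ht⟩ (Function.uncurry f)).symm
          · rw [indicator_of_notMem ht]
            exact (indicator_of_notMem (s := D) (a := (s, t)) (fun H => ht H.2) _).symm
        · rw [indicator_of_notMem hs]
          refine ((lintegral_congr fun t => ?_).trans lintegral_zero).symm
          exact indicator_of_notMem (s := D) (a := (s, t)) (fun H => hs H.1) _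
    _ = ∫⁻ s, ∫⁻ r, g (s, s + r) :=
        lintegral_congr fun s => (lintegral_add_left_eq_self (fun t => g (s, t)) s).symm
    _ = ∫⁻ r, ∫⁻ s, g (s, s + r) :=
        lintegral_lintegral_swap (hg.comp (by fun_prop : Measurable
          fun z : ℝ × ℝ => (z.1, z.1 + z.2))).aemeasurable
    _ ≤ ∫⁻ r, (Ioo (-h) h).indicator (fun _ => ω) r := lintegral_mono hslice
    _ = ENNReal.ofReal (2 * h) * ω := by
        rw [lintegral_indicator measurableSet_Ioo, setLIntegral_const, Real.volume_Ioo, mul_comm]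
        congr 2
        ring

section

variable {B : Type*} [NormedAddCommGroup B]

/-- An essential bound on the small translates of `u` bounds the oscillation of `u` at almost all
pairs of nearby points. -/
theorem ae_ae_norm_sub_le {T h ω : ℝ} {u : ℝ → B} (hu : StronglyMeasurable u)
    (hω : ∀ r ∈ Ioo 0 h, ∀ᵐ s ∂(volume.restrict (Ioo 0 (T - r))), ‖u (s + r) - u s‖ ≤ ω)
    (hω0 : 0 ≤ ω) :
    ∀ᵐ s ∂(volume.restrict (Ioo 0 T)), ∀ᵐ t ∂(volume.restrict (Ioo 0 T)),
      t ∈ Ioo (s - h) (s + h) → ‖u t - u s‖ ≤ ω := by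
  set D : Set (ℝ × ℝ) := {z | ω < ‖u z.2 - u z.1‖}
  have hD : MeasurableSet D := measurableSet_lt measurable_const
    ((hu.comp_measurable measurable_snd).sub (hu.comp_measurable measurable_fst)).norm.measurable
  -- The set of bad pairs has null slices along each translate, hence by the diagonal estimate with
  -- bound 0 it is null near the diagonal.
  set f : ℝ → ℝ → ℝ≥0∞ := fun s t => D.indicator 1 (s, t) with hfdef
  have hf : Measurable (Function.uncurry f) := measurable_one.indicator hD
  have key := lintegral_near_diagonal_le (T := T) (h := h) (ω := 0) hf
    (fun s t => by
      have : ((s, t) ∈ D) = ((t, s) ∈ D) := by simp only [D, mem_ofPred_eq, norm_sub_rev]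
      simp only [f, indicator_apply, this]; rfl)
    (fun s => by simp [f, D, indicator_apply, not_lt.2 hω0])
    (fun r hr => by
      refine le_of_eq ?_
      refine (lintegral_congr_ae (g := fun _ => 0) ?_).trans lintegral_zero
      filter_upwards [hω r hr] with s hs
      simp [f, D, indicator_apply, not_lt.2 hs])
  rw [mul_zero, nonpos_iff_eq_zero] at key
  rw [lintegral_eq_zero_iff (measurable_lintegral_near_diagonal hf)] at key
  filter_upwards [key] with s hs
  have hs' := (lintegral_eq_zero_iff (by exact hf.comp measurable_prodMk_left)).1 hs
  have h2 := (ae_restrict_iff' (measurableSet_Ioo.inter measurableSet_Ioo)).1 hs'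
  rw [ae_restrict_iff' measurableSet_Ioo]
  filter_upwards [h2] with t ht htT hth
  by_contra! hcon
  have := ht ⟨htT, hth⟩
  simp only [f, Pi.zero_apply, indicator_apply_eq_zero, Pi.one_apply, one_ne_zero, imp_false] at this
  exact this hcon

end

/-! ### Cells and sampling -/

/-- The `k`-th cell of the partition of `(0,T)` into intervals of length `h`. -/
def cell (T h : ℝ) (k : ℕ) : Set ℝ := {t | t ∈ Ioo 0 T ∧ ⌊t / h⌋₊ = k}

theorem measurableSet_cell (T h : ℝ) (k : ℕ) : MeasurableSet (cell T h k) :=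
  measurableSet_Ioo.inter ((Nat.measurable_floor.comp (measurable_id.div_const h))
    (measurableSet_singleton k))

theorem cell_subset (T h : ℝ) (k : ℕ) : cell T h k ⊆ Ioo 0 T := fun _ ht => ht.1

theorem pairwiseDisjoint_cell (T h : ℝ) (S : Set ℕ) : S.PairwiseDisjoint (cell T h) := by
  intro k _ l _ hkl
  exact disjoint_left.2 fun t hk hl => hkl (hk.2.symm.trans hl.2)

theorem floor_div_lt {T : ℝ} {K : ℕ} (hK : K ≠ 0) {t : ℝ} (ht : t ∈ Ioo 0 T) :
    ⌊t / (T / K)⌋₊ < K := by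
  have hK' : (0 : ℝ) < K := by exact_mod_cast Nat.pos_of_ne_zero hK
  have hT : 0 < T := ht.1.trans ht.2
  rw [Nat.floor_lt (div_nonneg ht.1.le (by positivity)), div_lt_iff₀ (by positivity)]
  rw [mul_div_cancel₀ _ hK'.ne']
  exact ht.2

theorem iUnion_cell {T : ℝ} {K : ℕ} (hK : K ≠ 0) :
    ⋃ k ∈ Finset.range K, cell T (T / K) k = Ioo 0 T := by
  ext t
  simp only [mem_iUnion, Finset.mem_range, exists_prop]
  exact ⟨fun ⟨_, _, h⟩ => h.1, fun h => ⟨_, floor_div_lt hK h, h, rfl⟩⟩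

theorem mem_Ioo_of_mem_cell {T h : ℝ} (hh : 0 < h) {k : ℕ} {s t : ℝ} (hs : s ∈ cell T h k)
    (ht : t ∈ cell T h k) : t ∈ Ioo (s - h) (s + h) := by
  have hs0 := (div_pos hs.1.1 hh).le
  have ht0 := (div_pos ht.1.1 hh).le
  have h1 := (Nat.floor_eq_iff hs0).1 hs.2
  have h2 := (Nat.floor_eq_iff ht0).1 ht.2
  rw [le_div_iff₀ hh, div_lt_iff₀ hh] at h1 h2
  constructor <;> nlinarith

theorem ofReal_le_volume_cell {T : ℝ} (hT : 0 < T) {K k : ℕ} (hk : k < K) :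
    ENNReal.ofReal (T / K) ≤ volume (cell T (T / K) k) := by
  have hK' : (0 : ℝ) < K := by exact_mod_cast (Nat.zero_le k).trans_lt hk
  set h := T / K with hh
  have hpos : 0 < h := by positivity
  have hT' : T = K * h := by rw [hh]; field_simp
  have hk' : (k : ℝ) + 1 ≤ K := by exact_mod_cast hk
  have hsub : Ioo (k * h) ((k + 1) * h) ⊆ cell T h k := by
    intro t ht
    have h0 : 0 ≤ (k : ℝ) * h := by positivity
    have ht0 : 0 < t := h0.trans_lt ht.1
    refine ⟨⟨ht0, ht.2.trans_le ?_⟩, ?_⟩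
    · rw [hT']; gcongr
    · rw [Nat.floor_eq_iff (div_pos ht0 hpos).le, le_div_iff₀ hpos, div_lt_iff₀ hpos]
      exact ⟨ht.1.le, ht.2⟩
  refine le_trans (le_of_eq ?_) (measure_mono hsub)
  rw [Real.volume_Ioo]
  congr 1
  ring

theorem volume_cell_ne_top (T h : ℝ) (k : ℕ) : volume (cell T h k) ≠ ∞ :=
  ((measure_mono (cell_subset T h k)).trans_lt (by simp)).ne

/-- A function is at most its average at some point outside any given null set. -/
theorem exists_mem_cell_of_ae {T : ℝ} (hT : 0 < T) {K k : ℕ} (hk : k < K) {P : ℝ → Prop}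
    (hP : ∀ᵐ t ∂(volume.restrict (Ioo 0 T)), P t) {f : ℝ → ℝ≥0∞}
    (hf : AEMeasurable f (volume.restrict (Ioo 0 T))) :
    ∃ s ∈ cell T (T / K) k, P s ∧
      ENNReal.ofReal (T / K) * f s ≤ ∫⁻ t in cell T (T / K) k, f t := by
  have hK' : (0 : ℝ) < K := by exact_mod_cast (Nat.zero_le k).trans_lt hk
  have hvol := ofReal_le_volume_cell hT hk
  have : IsFiniteMeasure (volume.restrict (cell T (T / K) k)) :=
    ⟨by simpa using (volume_cell_ne_top T (T / K) k).lt_top⟩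
  have hne : volume.restrict (cell T (T / K) k) ≠ 0 := by
    rw [Ne, Measure.restrict_eq_zero]
    exact ((ENNReal.ofReal_pos.2 (by positivity)).trans_le hvol).ne'
  have hle := Measure.restrict_mono (μ := volume) (cell_subset T (T / K) k) le_rfl
  have hae : ∀ᵐ t ∂(volume.restrict (cell T (T / K) k)), t ∈ cell T (T / K) k ∧ P t :=
    (ae_restrict_mem (measurableSet_cell _ _ _)).and (hP.filter_mono (ae_mono hle))
  obtain ⟨s, hs, hfs⟩ := exists_notMem_null_le_laverage hne (hf.mono_measure hle) hae
  rw [mem_compl_iff, not_not] at hs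
  refine ⟨s, hs.1, hs.2, ?_⟩
  rw [← measure_mul_setLAverage f (volume_cell_ne_top T (T / K) k)]
  gcongr

section

variable {B : Type*} [NormedAddCommGroup B]

theorem exists_samples_top {T : ℝ} (hT : 0 < T) {K : ℕ} (hK : K ≠ 0) {ε C : ℝ≥0} {u : ℝ → B}
    (hu : StronglyMeasurable u) {q : ℝ → ℝ}
    (hq : eLpNorm q ∞ (volume.restrict (Ioo 0 T)) ≤ C) {P : ℝ → Prop}
    (hP : ∀ᵐ t ∂(volume.restrict (Ioo 0 T)), P t)
    (hω : ∀ r ∈ Ioo 0 (T / K),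
      eLpNorm (fun t => u (t + r) - u t) ∞ (volume.restrict (Ioo 0 (T - r))) ≤ ε) :
    ∃ s : ℕ → ℝ, (∀ k < K, P (s k) ∧ q (s k) ≤ C) ∧
      eLpNorm (fun t => u t - u (s ⌊t / (T / K)⌋₊)) ∞ (volume.restrict (Ioo 0 T)) ≤ ε := by
  have hh : 0 < T / K := div_pos hT (by exact_mod_cast Nat.pos_of_ne_zero hK)
  have hq' : ∀ᵐ t ∂(volume.restrict (Ioo 0 T)), q t ≤ C := by
    filter_upwards [ae_le_eLpNormEssSup (f := q) (μ := volume.restrict (Ioo 0 T))] with t ht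
    rw [eLpNorm_exponent_top] at hq
    have := ht.trans hq
    rw [enorm_le_coe] at this
    exact (le_abs_self _).trans (by exact_mod_cast this)
  have hosc := ae_ae_norm_sub_le (T := T) (h := T / K) (ω := ε) hu (fun r hr => by
    have h1 := hω r hr
    rw [eLpNorm_exponent_top] at h1
    filter_upwards [ae_le_eLpNormEssSup (f := fun t => u (t + r) - u t)
      (μ := volume.restrict (Ioo 0 (T - r)))] with t ht
    have := ht.trans h1
    rw [enorm_le_coe] at this
    exact_mod_cast this) ε.2
  have hex : ∀ k, ∃ s, k < K → s ∈ cell T (T / K) k ∧ (P s ∧ q s ≤ C) ∧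
      ∀ᵐ t ∂(volume.restrict (Ioo 0 T)), t ∈ Ioo (s - T / K) (s + T / K) → ‖u t - u s‖ ≤ ε := by
    intro k
    by_cases hk : k < K
    · obtain ⟨s, hs, hPs, -⟩ := exists_mem_cell_of_ae hT hk ((hP.and hq').and hosc)
        (f := 0) aemeasurable_const
      exact ⟨s, fun _ => ⟨hs, hPs⟩⟩
    · exact ⟨0, fun h => absurd h hk⟩
  choose s hs using hex
  refine ⟨s, fun k hk => (hs k hk).2.1, ?_⟩
  rw [eLpNorm_exponent_top]
  refine eLpNormEssSup_le_of_ae_enorm_bound ?_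
  have hall : ∀ᵐ t ∂(volume.restrict (Ioo 0 T)), ∀ k, k < K →
      t ∈ Ioo (s k - T / K) (s k + T / K) → ‖u t - u (s k)‖ ≤ ε := by
    rw [ae_all_iff]
    intro k
    by_cases hk : k < K
    · filter_upwards [(hs k hk).2.2] with t ht _ using ht
    · exact Eventually.of_forall fun t h => absurd h hk
  filter_upwards [hall, ae_restrict_mem measurableSet_Ioo] with t ht htT
  have hk := floor_div_lt hK htT
  rw [enorm_le_coe]
  exact_mod_cast ht _ hk (mem_Ioo_of_mem_cell hh (hs _ hk).1 ⟨htT, rfl⟩)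

/-- The mean value choice is applied to one function, the local oscillation plus a small multiple c
of |q|^p, so a single sample controls both. The bound R is fixed before u and q, which makes it
uniform in n. -/
theorem exists_samples_of_ne_top {p : ℝ≥0∞} (hp : 1 ≤ p) (hp' : p ≠ ∞) {T : ℝ} (hT : 0 < T)
    {K : ℕ} (hK : K ≠ 0) {ε : ℝ≥0} (hε : ε ≠ 0) (C : ℝ≥0) :
    ∃ R : ℝ, ∀ (u : ℝ → B) (q : ℝ → ℝ) (P : ℝ → Prop), StronglyMeasurable u →
      AEStronglyMeasurable q (volume.restrict (Ioo 0 T)) →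
      eLpNorm q p (volume.restrict (Ioo 0 T)) ≤ C →
      (∀ᵐ t ∂(volume.restrict (Ioo 0 T)), P t) →
      (∀ r ∈ Ioo 0 (T / K),
        eLpNorm (fun t => u (t + r) - u t) p (volume.restrict (Ioo 0 (T - r))) ≤ (ε / 4 : ℝ≥0)) →
      ∃ s : ℕ → ℝ, (∀ k < K, P (s k) ∧ q (s k) ≤ R) ∧
        eLpNorm (fun t => u t - u (s ⌊t / (T / K)⌋₊)) p (volume.restrict (Ioo 0 T)) ≤ ε := by
  have hh : 0 < T / K := div_pos hT (by exact_mod_cast Nat.pos_of_ne_zero hK)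
  have hp0 : p ≠ 0 := (zero_lt_one.trans_le hp).ne'
  set e := p.toReal with he
  have he1 : 1 ≤ e := by
    rw [he, ← ENNReal.toReal_one]; exact ENNReal.toReal_mono hp' hp
  have he0 : 0 < e := zero_lt_one.trans_le he1
  set H : ℝ≥0∞ := ENNReal.ofReal (T / K) with hH
  have hH0 : H ≠ 0 := (ENNReal.ofReal_pos.2 hh).ne'
  have hHt : H ≠ ∞ := ENNReal.ofReal_ne_top
  set V : ℝ≥0∞ := H * (ε : ℝ≥0∞) ^ e with hV
  have hε0 : (ε : ℝ≥0∞) ^ e ≠ 0 := by simp [hε]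
  have hεt : (ε : ℝ≥0∞) ^ e ≠ ∞ := ENNReal.rpow_ne_top_of_nonneg he0.le ENNReal.coe_ne_top
  have hCt : (C : ℝ≥0∞) ^ e ≠ ∞ := ENNReal.rpow_ne_top_of_nonneg he0.le ENNReal.coe_ne_top
  have hV0 : V ≠ 0 := mul_ne_zero hH0 hε0
  have hVt : V ≠ ∞ := ENNReal.mul_ne_top hHt hεt
  -- Each summand of F gets half of the budget V; the added 1 keeps the denominator nonzero when C =
  -- 0.
  set c : ℝ≥0∞ := (V / 2) / ((C : ℝ≥0∞) ^ e + 1) with hc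
  have hc0 : c ≠ 0 := ENNReal.div_ne_zero.2
    ⟨ENNReal.div_ne_zero.2 ⟨hV0, by simp⟩, ENNReal.add_ne_top.2 ⟨hCt, ENNReal.one_ne_top⟩⟩
  have hct : c ≠ ∞ := ENNReal.div_ne_top (ENNReal.div_ne_top hVt (by simp)) (by simp)
  have hcC : c * (C : ℝ≥0∞) ^ e ≤ V / 2 :=
    (mul_le_mul_right le_self_add _).trans (ENNReal.div_mul_cancel (by simp)
      (ENNReal.add_ne_top.2 ⟨hCt, ENNReal.one_ne_top⟩)).le
  -- The window has width 2T/K, and 4^(-e) ≤ 1/4 since e ≥ 1.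
  have hquarter : ENNReal.ofReal (2 * (T / K)) * ((ε / 4 : ℝ≥0) : ℝ≥0∞) ^ e ≤ V / 2 := by
    have h1 : ((ε / 4 : ℝ≥0) : ℝ≥0∞) ^ e ≤ (ε : ℝ≥0∞) ^ e * 4⁻¹ := by
      rw [ENNReal.coe_div (by norm_num), div_eq_mul_inv, ENNReal.mul_rpow_of_nonneg _ _ he0.le]
      gcongr
      refine (ENNReal.rpow_le_rpow_of_exponent_ge ?_ he1).trans_eq ?_
      · exact ENNReal.inv_le_one.2 (by norm_num)
      · simp
    have h2 : (2 : ℝ≥0∞) * 4⁻¹ = 2⁻¹ := by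
      rw [show (4 : ℝ≥0∞) = 2 * 2 by norm_num, ENNReal.mul_inv (by simp) (by simp), ← mul_assoc,
        ENNReal.mul_inv_cancel (by simp) (by simp), one_mul]
    calc _ ≤ ENNReal.ofReal (2 * (T / K)) * ((ε : ℝ≥0∞) ^ e * 4⁻¹) := by gcongr
      _ = H * (ε : ℝ≥0∞) ^ e * (2 * 4⁻¹) := by
        rw [ENNReal.ofReal_mul (by norm_num), ENNReal.ofReal_ofNat]; ring
      _ = V / 2 := by rw [h2, hV, div_eq_mul_inv]
  refine ⟨(((ε : ℝ≥0∞) ^ e / c) ^ (1 / e)).toReal, fun u q P hu hqm hq hP hω => ?_⟩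
  set f : ℝ → ℝ → ℝ≥0∞ := fun s t => ‖u t - u s‖ₑ ^ e with hfdef
  have hf : Measurable (Function.uncurry f) :=
    ((hu.comp_measurable measurable_snd).sub
      (hu.comp_measurable measurable_fst)).enorm.pow_const e
  set A : ℝ → ℝ≥0∞ := fun s => ∫⁻ t in Ioo 0 T ∩ Ioo (s - T / K) (s + T / K), f s t with hA
  have hAm : Measurable A := measurable_lintegral_near_diagonal hf
  have hAint : ∫⁻ s in Ioo 0 T, A s ≤ V / 2 := by
    refine (lintegral_near_diagonal_le hf (fun s t => ?_) (fun s => ?_) fun r hr => ?_).trans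
      hquarter
    · simp only [f, ← edist_eq_enorm_sub, edist_comm]
    · simp [f, he0]
    · have := hω r hr
      rwa [eLpNorm_eq_lintegral_rpow_enorm_toReal hp0 hp', ← he, one_div, ENNReal.rpow_inv_le_iff he0] at this
  have hQint : ∫⁻ s in Ioo 0 T, ‖q s‖ₑ ^ e ≤ (C : ℝ≥0∞) ^ e := by
    rwa [eLpNorm_eq_lintegral_rpow_enorm_toReal hp0 hp', ← he, one_div, ENNReal.rpow_inv_le_iff he0] at hq
  set F : ℝ → ℝ≥0∞ := fun s => A s + c * ‖q s‖ₑ ^ e with hF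
  have hFm : AEMeasurable F (volume.restrict (Ioo 0 T)) :=
    hAm.aemeasurable.add ((hqm.enorm.pow_const e).const_mul c)
  have hFint : ∫⁻ s in Ioo 0 T, F s ≤ V := by
    rw [hF, lintegral_add_left hAm, lintegral_const_mul' _ _ hct, ← ENNReal.add_halves V]
    exact add_le_add hAint ((mul_le_mul_right hQint c).trans hcC)
  have hex : ∀ k, ∃ s, k < K → s ∈ cell T (T / K) k ∧ P s ∧
      H * F s ≤ ∫⁻ t in cell T (T / K) k, F t := by
    intro k
    by_cases hk : k < K
    · obtain ⟨s, hs⟩ := exists_mem_cell_of_ae hT hk hP hFm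
      exact ⟨s, fun _ => hs⟩
    · exact ⟨0, fun h => absurd h hk⟩
  choose s hs using hex
  have hsum : ∑ k ∈ Finset.range K, F (s k) ≤ (ε : ℝ≥0∞) ^ e := by
    rw [← ENNReal.mul_le_mul_iff_right hH0 hHt, Finset.mul_sum]
    calc _ ≤ ∑ k ∈ Finset.range K, ∫⁻ t in cell T (T / K) k, F t :=
          Finset.sum_le_sum fun k hk => (hs k (Finset.mem_range.1 hk)).2.2
      _ = ∫⁻ t in Ioo 0 T, F t := by
          rw [← lintegral_biUnion_finset (pairwiseDisjoint_cell _ _ _)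
            (fun k _ => measurableSet_cell _ _ k), iUnion_cell hK]
      _ ≤ V := hFint
  refine ⟨s, fun k hk => ⟨(hs k hk).2.1, ?_⟩, ?_⟩
  · have h1 : c * ‖q (s k)‖ₑ ^ e ≤ (ε : ℝ≥0∞) ^ e :=
      le_add_self.trans ((Finset.single_le_sum (f := fun k => F (s k)) (fun _ _ => zero_le)
        (Finset.mem_range.2 hk)).trans hsum)
    have h2 : ‖q (s k)‖ₑ ≤ ((ε : ℝ≥0∞) ^ e / c) ^ (1 / e) := by
      rw [one_div, ENNReal.le_rpow_inv_iff he0, ENNReal.le_div_iff_mul_le (Or.inl hc0) (Or.inl hct),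
        mul_comm]
      exact h1
    have h3 := ENNReal.toReal_mono
      (ENNReal.rpow_ne_top_of_nonneg (by positivity) (ENNReal.div_ne_top hεt hc0)) h2
    rw [toReal_enorm] at h3
    exact (le_abs_self _).trans h3
  · rw [eLpNorm_eq_lintegral_rpow_enorm_toReal hp0 hp', ← he, one_div, ENNReal.rpow_inv_le_iff he0]
    refine le_trans ?_ hsum
    rw [← iUnion_cell hK, lintegral_biUnion_finset (pairwiseDisjoint_cell _ _ _)
            (fun k _ => measurableSet_cell _ _ k)]
    refine Finset.sum_le_sum fun k hk => ?_
    have hsk := (hs k (Finset.mem_range.1 hk)).1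
    refine le_trans ?_ (le_self_add : A (s k) ≤ F (s k))
    refine (setLIntegral_congr_fun (measurableSet_cell _ _ k) fun t ht => ?_).trans_le
      (lintegral_mono_set (f := f (s k)) fun t ht => ⟨ht.1, mem_Ioo_of_mem_cell hh hsk ht⟩)
    simp only [f, ht.2]

/-- Functions with small translates are approximated in `L^p` by piecewise constant functions whose
values are samples with a controlled value of `q`. -/
theorem exists_samples {p : ℝ≥0∞} (hp : 1 ≤ p) {T : ℝ} (hT : 0 < T)
    {K : ℕ} (hK : K ≠ 0) {ε : ℝ≥0} (hε : ε ≠ 0) (C : ℝ≥0) :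
    ∃ R : ℝ, ∀ (u : ℝ → B) (q : ℝ → ℝ) (P : ℝ → Prop), StronglyMeasurable u →
      AEStronglyMeasurable q (volume.restrict (Ioo 0 T)) →
      eLpNorm q p (volume.restrict (Ioo 0 T)) ≤ C →
      (∀ᵐ t ∂(volume.restrict (Ioo 0 T)), P t) →
      (∀ r ∈ Ioo 0 (T / K),
        eLpNorm (fun t => u (t + r) - u t) p (volume.restrict (Ioo 0 (T - r))) ≤ (ε / 4 : ℝ≥0)) →
      ∃ s : ℕ → ℝ, (∀ k < K, P (s k) ∧ q (s k) ≤ R) ∧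
        eLpNorm (fun t => u t - u (s ⌊t / (T / K)⌋₊)) p (volume.restrict (Ioo 0 T)) ≤ ε := by
  by_cases hp' : p = ∞
  · subst hp'
    refine ⟨C, fun u q P hu _ hq hP hω => exists_samples_top hT hK hu hq hP fun r hr => ?_⟩
    refine (hω r hr).trans ?_
    have : ε / 4 ≤ ε := div_le_self zero_le (by norm_num)
    exact_mod_cast this
  · exact exists_samples_of_ne_top hp hp' hT hK hε C

end

/-! ### Translates and continuous representatives -/

theorem measurePreserving_add_right_Ioo (T h : ℝ) :
    MeasurePreserving (fun t : ℝ => t + h) (volume.restrict (Ioo 0 (T - h)))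
      (volume.restrict (Ioo h T)) := by
  have := (measurePreserving_add_right (volume : Measure ℝ) h).restrict_preimage
    (measurableSet_Ioo (a := h) (b := T))
  rwa [preimage_add_const_Ioo, sub_self] at this

theorem ae_and_ae_add {T h : ℝ} (hh : 0 ≤ h) {P : ℝ → Prop}
    (hP : ∀ᵐ t ∂(volume.restrict (Ioo 0 T)), P t) :
    ∀ᵐ t ∂(volume.restrict (Ioo 0 (T - h))), P t ∧ P (t + h) := by
  refine Eventually.and ?_ ?_
  · exact hP.filter_mono (ae_mono (Measure.restrict_mono (Ioo_subset_Ioo_right (by linarith)) le_rfl))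
  · exact (measurePreserving_add_right_Ioo T h).quasiMeasurePreserving.ae (hP.filter_mono
      (ae_mono (Measure.restrict_mono (Ioo_subset_Ioo_left hh) le_rfl)))

theorem MeasureTheory.AEStronglyMeasurable.comp_add_Ioo {F : Type*} [NormedAddCommGroup F]
    {T h : ℝ} (hh : 0 ≤ h) {f : ℝ → F}
    (hf : AEStronglyMeasurable f (volume.restrict (Ioo 0 T))) :
    AEStronglyMeasurable f (volume.restrict (Ioo 0 (T - h))) ∧
    AEStronglyMeasurable (fun t => f (t + h)) (volume.restrict (Ioo 0 (T - h))) :=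
  ⟨hf.mono_measure (Measure.restrict_mono (Ioo_subset_Ioo_right (by linarith)) le_rfl),
    (hf.mono_measure (Measure.restrict_mono (Ioo_subset_Ioo_left hh)
      le_rfl)).comp_measurePreserving (measurePreserving_add_right_Ioo T h)⟩

theorem eLpNorm_add_Ioo_le {F : Type*} [NormedAddCommGroup F] {T h : ℝ} (hh : 0 ≤ h) {f : ℝ → F}
    {p : ℝ≥0∞} (hf : AEStronglyMeasurable f (volume.restrict (Ioo 0 T))) :
    eLpNorm (fun t => f (t + h)) p (volume.restrict (Ioo 0 (T - h)))
      ≤ eLpNorm f p (volume.restrict (Ioo 0 T)) := by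
  have hle := Measure.restrict_mono (μ := volume) (Ioo_subset_Ioo_left hh : Ioo h T ⊆ Ioo 0 T) le_rfl
  exact (eLpNorm_comp_measurePreserving (hf.mono_measure hle)
    (measurePreserving_add_right_Ioo T h)).trans_le (eLpNorm_mono_measure _ hle)

section

variable {B : Type*} [NormedAddCommGroup B]

theorem eLpNorm_shift_congr {T h : ℝ} (hh : 0 ≤ h) {p : ℝ≥0∞} {u v : ℝ → B}
    (huv : u =ᵐ[volume.restrict (Ioo 0 T)] v) :
    eLpNorm (fun t => u (t + h) - u t) p (volume.restrict (Ioo 0 (T - h))) =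
      eLpNorm (fun t => v (t + h) - v t) p (volume.restrict (Ioo 0 (T - h))) := by
  refine eLpNorm_congr_ae ?_
  filter_upwards [ae_and_ae_add hh huv] with t ht
  rw [ht.1, ht.2]

theorem Ioo_nonempty_inter_of_ae {T : ℝ} {P : ℝ → Prop}
    (hP : ∀ᵐ t ∂(volume.restrict (Ioo 0 T)), P t) {U : Set ℝ} (hU : IsOpen U)
    (hne : (Ioo 0 T ∩ U).Nonempty) : ∃ t ∈ Ioo 0 T ∩ U, P t := by
  rw [ae_restrict_iff' measurableSet_Ioo] at hP
  by_contra! hcon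
  refine ((isOpen_Ioo.inter hU).measure_pos volume hne).ne' (measure_mono_null ?_ hP)
  intro t ht h
  exact hcon t ht (h ht.1)

/-- A function whose translates converge essentially uniformly has a continuous representative. -/
theorem exists_continuous_representative [CompleteSpace B] {T : ℝ} (hT : 0 < T) {u : ℝ → B}
    (hu : AEStronglyMeasurable u (volume.restrict (Ioo 0 T)))
    (hω : ∀ ε : ℝ≥0, ε ≠ 0 → ∃ δ > 0, ∀ r ∈ Ioo 0 δ,
      eLpNorm (fun t => u (t + r) - u t) ∞ (volume.restrict (Ioo 0 (T - r))) ≤ ε) :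
    ∃ U : C(Icc (0 : ℝ) T, B), ∀ᵐ t ∂(volume.restrict (Ioo 0 T)), ∀ ht : t ∈ Icc 0 T,
      u t = U ⟨t, ht⟩ := by
  set v := hu.mk u
  have huv : u =ᵐ[volume.restrict (Ioo 0 T)] v := hu.ae_eq_mk
  have hosc : ∀ n : ℕ, ∃ δ > 0, ∀ᵐ s ∂(volume.restrict (Ioo 0 T)),
      ∀ᵐ t ∂(volume.restrict (Ioo 0 T)), t ∈ Ioo (s - δ) (s + δ) →
        ‖v t - v s‖ ≤ ((n + 1 : ℝ≥0)⁻¹ : ℝ≥0) := by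
    intro n
    obtain ⟨δ, hδ, h⟩ := hω (n + 1 : ℝ≥0)⁻¹ (by positivity)
    refine ⟨δ, hδ, ae_ae_norm_sub_le hu.stronglyMeasurable_mk (fun r hr => ?_) (NNReal.coe_nonneg _)⟩
    have h1 := h r hr
    rw [eLpNorm_shift_congr hr.1.le huv, eLpNorm_exponent_top] at h1
    filter_upwards [ae_le_eLpNormEssSup (f := fun t => v (t + r) - v t)
      (μ := volume.restrict (Ioo 0 (T - r)))] with t ht
    have := ht.trans h1
    rw [enorm_le_coe] at this
    exact_mod_cast this
  choose δ hδ hosc using hosc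
  set G : Set ℝ := {s | s ∈ Ioo 0 T ∧ ∀ n, ∀ᵐ t ∂(volume.restrict (Ioo 0 T)),
    t ∈ Ioo (s - δ n) (s + δ n) → ‖v t - v s‖ ≤ ((n + 1 : ℝ≥0)⁻¹ : ℝ≥0)} with hG
  have hGae : ∀ᵐ s ∂(volume.restrict (Ioo 0 T)), s ∈ G :=
    (ae_restrict_mem measurableSet_Ioo).and (ae_all_iff.2 hosc)
  have hclose : ∀ n, ∀ s ∈ G, ∀ s' ∈ G, |s - s'| < δ n →
      dist (v s) (v s') ≤ 2 * ((n + 1 : ℝ≥0)⁻¹ : ℝ≥0) := by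
    intro n s hs s' hs' hd
    rw [abs_lt] at hd
    -- The exceptional null sets depend on s and s', so the two values are compared through a common
    -- nearby t that avoids both.
    obtain ⟨t, ht, h1, h2⟩ := Ioo_nonempty_inter_of_ae ((hs.2 n).and (hs'.2 n))
      (U := Ioo (s - δ n) (s + δ n) ∩ Ioo (s' - δ n) (s' + δ n)) (isOpen_Ioo.inter isOpen_Ioo)
      ⟨s, hs.1, ⟨by linarith [hδ n], by linarith [hδ n]⟩, ⟨by linarith, by linarith⟩⟩
    have h3 := h1 ht.2.1
    have h4 := h2 ht.2.2
    rw [← dist_eq_norm] at h3 h4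
    linarith [dist_triangle_left (v s) (v s') (v t)]
  set D : Set (Icc (0 : ℝ) T) := {x | x.1 ∈ G} with hDdef
  have hD : Dense D := by
    intro x
    rw [Metric.mem_closure_iff]
    intro ε hε
    have hx : x.1 ∈ closure (Ioo 0 T) := by rw [closure_Ioo hT.ne]; exact x.2
    obtain ⟨y, hy, hxy⟩ := Metric.mem_closure_iff.1 hx ε hε
    obtain ⟨t, ht, htG⟩ := Ioo_nonempty_inter_of_ae hGae (Metric.isOpen_ball (x := x.1) (ε := ε))
      ⟨y, hy, by rwa [Metric.mem_ball, dist_comm]⟩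
    exact ⟨⟨t, Ioo_subset_Icc_self ht.1⟩, htG, by rw [dist_comm]; exact ht.2⟩
  have huc : UniformContinuous fun x : D => v x.1.1 := by
    rw [Metric.uniformContinuous_iff]
    intro ε hε
    obtain ⟨n, hn⟩ := exists_nat_one_div_lt (half_pos hε)
    refine ⟨δ n, hδ n, fun {x y} hxy => ?_⟩
    refine (hclose n _ x.2 _ y.2 hxy).trans_lt ?_
    have : (((n + 1 : ℝ≥0)⁻¹ : ℝ≥0) : ℝ) = 1 / ((n : ℝ) + 1) := by simp
    rw [this]
    linarith
  refine ⟨⟨hD.extend fun x : D => v x.1.1, (hD.uniformContinuous_extend huc).continuous⟩, ?_⟩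
  filter_upwards [hGae, huv] with t htG htv ht
  rw [htv]
  exact (hD.extend_of_ind huc ⟨⟨t, ht⟩, htG⟩).symm

end

/-! ### From translates in Y to compactness in L^p -/

section

variable {B : Type*} [NormedAddCommGroup B] [NormedSpace ℝ B] {E : Type*} [AddCommGroup E]
  [Module ℝ E]

section

variable {Y : Type*} [NormedAddCommGroup Y] [NormedSpace ℝ Y]

/-- Ehrling's inequality at almost every t, for the pair u(t + h), u(t), followed by Minkowski. -/
theorem eLpNorm_shift_le_of_ehrlingWith {M : SeminormedCone B} {ι : B →ₗ[ℝ] E} {j : Y →ₗ[ℝ] E}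
    (hj : Function.Injective j) {p : ℝ≥0∞} (hp : 1 ≤ p) {T : ℝ} {u : ℝ → B}
    (hu : MemLpCone M ι j p T u) {C : ℝ≥0∞}
    (hC : eLpNorm (fun t => M.semi (u t)) p (volume.restrict (Ioo 0 T)) ≤ C) {ε L : ℝ≥0}
    (hE : EhrlingWith M ι j ε L) {h : ℝ} (hh : 0 ≤ h) :
    eLpNorm (fun t => u (t + h) - u t) p (volume.restrict (Ioo 0 (T - h)))
      ≤ ε * (C + C) + L * shiftNorm ι j p T u h := by
  obtain ⟨v, hv, hvu⟩ := hu.measurable_in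
  have hgood := ae_and_ae_add hh (hu.mem_cone.and hvu)
  have hshift : shiftNorm ι j p T u h =
      eLpNorm (fun t => v (t + h) - v t) p (volume.restrict (Ioo 0 (T - h))) := by
    refine eLpNorm_congr_enorm_ae ?_
    filter_upwards [hgood] with t ht
    rw [enorm_eq_self]
    exact normIn_eq ι j hj (by rw [map_sub, map_sub, ht.1.2, ht.2.2])
  set q := fun t => M.semi (u t)
  have hq := (hu.memLp_semi.1).comp_add_Ioo hh
  have hv' := hv.comp_add_Ioo hh
  calc _ ≤ eLpNorm ((ε : ℝ) • ((fun t => q (t + h)) + q) + (L : ℝ) • fun t => ‖v (t + h) - v t‖) p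
        (volume.restrict (Ioo 0 (T - h))) := by
        refine eLpNorm_mono_ae ?_
        filter_upwards [hgood] with t ht
        refine le_trans ?_ (le_abs_self _)
        exact hE _ ht.2.1 _ ht.1.1 _ _ ht.2.2 ht.1.2
    _ ≤ eLpNorm ((ε : ℝ) • ((fun t => q (t + h)) + q)) p (volume.restrict (Ioo 0 (T - h))) +
        eLpNorm ((L : ℝ) • fun t => ‖v (t + h) - v t‖) p (volume.restrict (Ioo 0 (T - h))) :=
        eLpNorm_add_le ((hq.2.add hq.1).const_smul _) ((hv'.2.sub hv'.1).norm.const_smul _) hp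
    _ ≤ _ := by
        rw [eLpNorm_const_smul, eLpNorm_const_smul, eLpNorm_norm, ← hshift]
        have hn : ∀ c : ℝ≥0, ‖(c : ℝ)‖ₑ = c := fun c => by
          exact (Real.enorm_eq_ofReal c.2).trans (ENNReal.ofReal_coe_nnreal)
        rw [hn, hn]
        gcongr
        refine (eLpNorm_add_le hq.2 hq.1 hp).trans (add_le_add ?_ ?_)
        · exact (eLpNorm_add_Ioo_le hh hu.memLp_semi.1).trans hC
        · exact (eLpNorm_mono_measure _ (Measure.restrict_mono
            (Ioo_subset_Ioo_right (by linarith)) le_rfl)).trans hC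

theorem MemLpCone.memLp {M : SeminormedCone B} (hM : M.ContinuouslyEmbedded) {ι : B →ₗ[ℝ] E}
    {j : Y →ₗ[ℝ] E} {p : ℝ≥0∞} {T : ℝ} {u : ℝ → B} (hu : MemLpCone M ι j p T u) :
    MemLp u p (volume.restrict (Ioo 0 T)) := by
  obtain ⟨C, -, hC⟩ := hM
  refine (hu.memLp_semi.const_mul C).mono hu.aestronglyMeasurable ?_
  filter_upwards [hu.mem_cone] with t ht using (hC _ ht).trans (le_abs_self _)

theorem MemLpCone.nonempty {M : SeminormedCone B} {ι : B →ₗ[ℝ] E}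
    {j : Y →ₗ[ℝ] E} {p : ℝ≥0∞} {T : ℝ} (hT : 0 < T) {u : ℝ → B} (hu : MemLpCone M ι j p T u) :
    M.carrier.Nonempty := by
  obtain ⟨t, -, ht⟩ := Ioo_nonempty_inter_of_ae hu.mem_cone isOpen_univ
    (by simpa using nonempty_Ioo.2 hT)
  exact ⟨_, ht⟩

end

/-- Small constants for Ehrling's inequality make translates small in `B`. -/
theorem exists_shift_le {Y : ℕ → Type*} [∀ n, NormedAddCommGroup (Y n)]
    [∀ n, NormedSpace ℝ (Y n)] {M : ℕ → SeminormedCone B} {ι : B →ₗ[ℝ] E}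
    {j : ∀ n, Y n →ₗ[ℝ] E} (hj : ∀ n, Function.Injective (j n)) {p : ℝ≥0∞} (hp : 1 ≤ p) {T : ℝ}
    {u : ℕ → ℝ → B} (hu : ∀ n, MemLpCone (M n) ι (j n) p T (u n)) {C : ℝ≥0}
    (hC : ∀ n, eLpNorm (fun t => (M n).semi (u n t)) p (volume.restrict (Ioo 0 T)) ≤ C)
    (hshift : Tendsto (fun h : ℝ => ⨆ n, shiftNorm ι (j n) p T (u n) h) (𝓝[>] 0) (𝓝 0))
    {l : Filter ℕ} (hE : ∀ ε : ℝ, 0 < ε → ∃ L : ℝ, 0 ≤ L ∧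
      ∀ᶠ n in l, EhrlingWith (M n) ι (j n) ε L) {ε : ℝ≥0} (hε : ε ≠ 0) :
    ∃ δ > 0, ∀ᶠ n in l, ∀ r ∈ Ioo 0 δ,
      eLpNorm (fun t => u n (t + r) - u n t) p (volume.restrict (Ioo 0 (T - r))) ≤ ε := by
  have hε' : 0 < ε := pos_of_ne_zero hε
  -- η must be fixed first, because L depends on it; κ then depends on L.
  set η : ℝ≥0 := ε / 2 / (2 * C + 1) with hη
  obtain ⟨L, hL0, hL⟩ := hE η (by have : 0 < η := by positivity
                                  exact_mod_cast this)
  lift L to ℝ≥0 using hL0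
  set κ : ℝ≥0 := ε / 2 / (L + 1) with hκ
  have hκ0 : 0 < κ := by positivity
  have hev := hshift.eventually_le_const (u := (κ : ℝ≥0∞)) (by exact_mod_cast hκ0)
  obtain ⟨δ, hδ, hδs⟩ := (mem_nhdsGT_iff_exists_Ioo_subset).1 hev
  refine ⟨δ, hδ, ?_⟩
  filter_upwards [hL] with n hn r hr
  refine (eLpNorm_shift_le_of_ehrlingWith (hj n) hp (hu n) (hC n) hn hr.1.le).trans ?_
  have h1 : shiftNorm ι (j n) p T (u n) r ≤ κ :=
    (le_iSup (fun n => shiftNorm ι (j n) p T (u n) r) n).trans (hδs hr)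
  have h2 : η * (C + C) + L * κ ≤ ε := by
    have h3 : η * (2 * C + 1) = ε / 2 := div_mul_cancel₀ _ (by positivity)
    have h4 : κ * (L + 1) = ε / 2 := div_mul_cancel₀ _ (by positivity)
    calc η * (C + C) + L * κ = η * (2 * C) + κ * L := by ring
      _ ≤ η * (2 * C + 1) + κ * (L + 1) := by gcongr <;> exact le_self_add
      _ = ε := by rw [h3, h4, add_halves]
  calc _ ≤ (η : ℝ≥0∞) * (C + C) + L * κ := by gcongr
    _ ≤ ε := by exact_mod_cast h2

/-- Compactness in `L^p` from compactness of the cones and late equicontinuity of translates. -/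
theorem isCompact_closure_range_toLp [CompleteSpace B] {M : ℕ → SeminormedCone B}
    (hcompact : CompactAlong M id) (hne : ∀ n, (M n).carrier.Nonempty) {p : ℝ≥0∞} [Fact (1 ≤ p)]
    {T : ℝ} (hT : 0 < T) {u : ℕ → ℝ → B} (hLp : ∀ n, MemLp (u n) p (volume.restrict (Ioo 0 T)))
    (hmem : ∀ n, ∀ᵐ t ∂(volume.restrict (Ioo 0 T)), u n t ∈ (M n).carrier)
    (hq : ∀ n, AEStronglyMeasurable (fun t => (M n).semi (u n t)) (volume.restrict (Ioo 0 T)))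
    {C : ℝ≥0}
    (hC : ∀ n, eLpNorm (fun t => (M n).semi (u n t)) p (volume.restrict (Ioo 0 T)) ≤ C)
    (hω : ∀ ε : ℝ≥0, ε ≠ 0 → ∃ δ > 0, ∀ᶠ n in atTop, ∀ r ∈ Ioo 0 δ,
      eLpNorm (fun t => u n (t + r) - u n t) p (volume.restrict (Ioo 0 (T - r))) ≤ ε) :
    IsCompact (closure (range fun n => (hLp n).toLp (u n))) := by
  classical
  have hp : 1 ≤ p := Fact.out
  refine isCompact_closure_range_of_net fun ε hε => ?_
  set η : ℝ≥0 := (ε / 4).toNNReal with hη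
  have hηε : (η : ℝ) = ε / 4 := Real.coe_toNNReal _ (by positivity)
  have hη0 : η ≠ 0 := by
    intro h; rw [h] at hηε; simp at hηε; linarith
  obtain ⟨δ, hδ, hev⟩ := hω (η / 4) (div_ne_zero hη0 (by norm_num))
  obtain ⟨N, hN⟩ := eventually_atTop.1 hev
  obtain ⟨K, hK⟩ := exists_nat_gt (T / δ)
  have hKpos : (0 : ℝ) < K := (div_pos hT hδ).trans hK
  have hK0 : K ≠ 0 := by rintro rfl; simp at hKpos
  have hKδ : T / K < δ := by rwa [div_lt_comm₀ hKpos hδ]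
  obtain ⟨R, hR⟩ := exists_samples (B := B) hp hT hK0 hη0 C
  have hex : ∀ n, ∃ s : ℕ → ℝ, N ≤ n →
      (∀ k < K, u n (s k) ∈ (M n).carrier ∧ (M n).semi (u n (s k)) ≤ R) ∧
      ∃ w : ℕ → B, (∀ k < K, w k = u n (s k)) ∧
        eLpNorm (fun t => u n t - w ⌊t / (T / K)⌋₊) p (volume.restrict (Ioo 0 T)) ≤ η := by
    intro n
    by_cases hn : N ≤ n
    · have haeq := (hLp n).1.ae_eq_mk
      obtain ⟨s, hs, hle⟩ := hR ((hLp n).1.mk (u n)) (fun t => (M n).semi (u n t))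
        (fun t => u n t = (hLp n).1.mk (u n) t ∧ u n t ∈ (M n).carrier)
        (hLp n).1.stronglyMeasurable_mk (hq n) (hC n) (haeq.and (hmem n)) (fun r hr => by
          rw [← eLpNorm_shift_congr hr.1.le haeq]
          exact hN n hn r ⟨hr.1, hr.2.trans hKδ⟩)
      refine ⟨s, fun _ => ⟨fun k hk => ⟨(hs k hk).1.2, (hs k hk).2⟩,
        fun k => (hLp n).1.mk (u n) (s k), fun k hk => (hs k hk).1.1.symm, ?_⟩⟩
      refine (eLpNorm_congr_ae ?_).trans_le hle
      filter_upwards [haeq] with t ht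
      rw [← ht]
    · exact ⟨0, fun h => absurd h hn⟩
  choose s hs using hex
  -- Early terms have no controlled samples; 0 keeps the sequence in the cones so that (a) applies
  -- to each coordinate.
  set a : ℕ → Fin K → B := fun n k => if N ≤ n then u n (s n k) else 0 with ha
  have hatb : TotallyBounded (range a) := by
    have hcpt : ∀ k : Fin K, IsCompact (closure (range fun n => a n k)) := by
      intro k
      refine hcompact _ (fun n => ?_) ⟨max R 0, fun n => ?_⟩
      · by_cases hn : N ≤ n
        · simp only [ha, if_pos hn]; exact ((hs n hn).1 k k.2).1
        · simp only [ha, if_neg hn]; exact (M n).zero_mem (hne n)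
      · by_cases hn : N ≤ n
        · simp only [ha, if_pos hn]; exact ((hs n hn).1 k k.2).2.trans (le_max_left _ _)
        · simp only [ha, if_neg hn]; exact ((M n).semi_zero (hne n)).trans_le (le_max_right _ _)
    refine (isCompact_univ_pi hcpt).totallyBounded.subset ?_
    rintro _ ⟨n, rfl⟩ k -
    exact subset_closure (mem_range_self n)
  -- D is T^(1/p), and equals 1 for p = ∞ since then `p.toReal⁻¹` is 0.
  obtain ⟨D, hD⟩ : ∃ D : ℝ≥0, (D : ℝ≥0∞) = (volume.restrict (Ioo 0 T)) univ ^ p.toReal⁻¹ :=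
    ENNReal.canLift.prf _ (ENNReal.rpow_ne_top_of_nonneg (by positivity) (by simp))
  have hδ' : (0 : ℝ) < η / (D + 1) := by
    have : 0 < η := pos_of_ne_zero hη0
    positivity
  refine exists_finite_net_of_totallyBounded _ a hatb hε hδ' N fun n m hn hm hd => ?_
  obtain ⟨wn, hwn, hun⟩ := (hs n hn).2
  obtain ⟨wm, hwm, hum⟩ := (hs m hm).2
  have hfloor : Measurable fun t : ℝ => ⌊t / (T / K)⌋₊ :=
    Nat.measurable_floor.comp (measurable_id.div_const _)
  have hmeas : ∀ w : ℕ → B, AEStronglyMeasurable (fun t : ℝ => w ⌊t / (T / K)⌋₊)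
      (volume.restrict (Ioo 0 T)) := fun w =>
    (StronglyMeasurable.of_discrete.comp_measurable hfloor).aestronglyMeasurable
  have hstep : eLpNorm (fun t : ℝ => wn ⌊t / (T / K)⌋₊ - wm ⌊t / (T / K)⌋₊) p
      (volume.restrict (Ioo 0 T)) ≤ η := by
    refine (eLpNorm_le_of_ae_bound (C := η / (D + 1)) ?_).trans ?_
    · filter_upwards [ae_restrict_mem measurableSet_Ioo] with t ht
      have hk := floor_div_lt hK0 ht
      have h1 := (dist_le_pi_dist (a n) (a m) ⟨_, hk⟩).trans hd.le
      simp only [ha, if_pos hn, if_pos hm] at h1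
      rwa [hwn _ hk, hwm _ hk, ← dist_eq_norm]
    · rw [← hD, show (η : ℝ) / (D + 1) = ((η / (D + 1) : ℝ≥0) : ℝ) by push_cast; rfl,
        ENNReal.ofReal_coe_nnreal]
      have : D * (η / (D + 1)) ≤ η := by
        calc D * (η / (D + 1)) ≤ (D + 1) * (η / (D + 1)) := by gcongr; exact le_self_add
          _ = η := mul_div_cancel₀ _ (by positivity)
      exact_mod_cast this
  have hmn : eLpNorm (u n - u m) p (volume.restrict (Ioo 0 T)) ≤ η + η + η := by
    have heq : u n - u m = ((fun t => u n t - wn ⌊t / (T / K)⌋₊) +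
        fun t => wn ⌊t / (T / K)⌋₊ - wm ⌊t / (T / K)⌋₊) -
        fun t => u m t - wm ⌊t / (T / K)⌋₊ := by
      ext t; simp
    rw [heq]
    have m1 := (hLp n).1.sub (hmeas wn)
    have m2 := (hmeas wn).sub (hmeas wm)
    refine (eLpNorm_sub_le (m1.add m2) ((hLp m).1.sub (hmeas wm)) hp).trans ?_
    exact add_le_add ((eLpNorm_add_le m1 m2 hp).trans (add_le_add hun hstep)) hum
  rw [← Lp.edist_toLp_toLp _ _ (hLp n) (hLp m)] at hmn
  have h3 : edist ((hLp n).toLp (u n)) ((hLp m).toLp (u m)) ≤ ((η + η + η : ℝ≥0) : ℝ≥0∞) := by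
    exact_mod_cast hmn
  rw [edist_le_coe, ← NNReal.coe_le_coe, coe_nndist] at h3
  push_cast at h3
  linarith

end

/-! ### Uniform convergence and conclusion -/

/-- The pointwise bound holds on a set of full measure, hence dense in [0,T], and is a closed
condition. -/
theorem dist_continuousMap_le_dist_toLp {B : Type*} [NormedAddCommGroup B] {T : ℝ} (hT : 0 < T)
    {u v : ℝ → B} (hu : MemLp u ∞ (volume.restrict (Ioo 0 T)))
    (hv : MemLp v ∞ (volume.restrict (Ioo 0 T))) {U V : C(Icc (0 : ℝ) T, B)}
    (hU : ∀ᵐ t ∂(volume.restrict (Ioo 0 T)), ∀ ht : t ∈ Icc 0 T, u t = U ⟨t, ht⟩)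
    (hV : ∀ᵐ t ∂(volume.restrict (Ioo 0 T)), ∀ ht : t ∈ Icc 0 T, v t = V ⟨t, ht⟩) :
    dist U V ≤ dist (hu.toLp u) (hv.toLp v) := by
  refine (ContinuousMap.dist_le dist_nonneg).2 ?_
  set d := dist (hu.toLp u) (hv.toLp v)
  have hae : ∀ᵐ t ∂(volume.restrict (Ioo 0 T)), ∀ ht : t ∈ Icc 0 T,
      dist (U ⟨t, ht⟩) (V ⟨t, ht⟩) ≤ d := by
    filter_upwards [hU, hV, ae_le_eLpNormEssSup (f := u - v)
      (μ := volume.restrict (Ioo 0 T))] with t h1 h2 h3 ht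
    rw [← h1 ht, ← h2 ht]
    rw [← eLpNorm_exponent_top, ← Lp.edist_toLp_toLp _ _ hu hv, Pi.sub_apply,
      ← edist_eq_enorm_sub, edist_dist, edist_dist] at h3
    exact (ENNReal.ofReal_le_ofReal_iff dist_nonneg).1 h3
  have hclosed : IsClosed {x : Icc (0 : ℝ) T | dist (U x) (V x) ≤ d} :=
    isClosed_le (by fun_prop) continuous_const
  intro x
  refine hclosed.closure_subset (Metric.mem_closure_iff.2 fun ε hε => ?_)
  have hx : x.1 ∈ closure (Ioo 0 T) := by rw [closure_Ioo hT.ne]; exact x.2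
  obtain ⟨y, hy, hxy⟩ := Metric.mem_closure_iff.1 hx ε hε
  obtain ⟨t, ht, htd⟩ := Ioo_nonempty_inter_of_ae hae (Metric.isOpen_ball (x := x.1) (ε := ε))
    ⟨y, hy, by rwa [Metric.mem_ball, dist_comm]⟩
  exact ⟨⟨t, Ioo_subset_Icc_self ht.1⟩, htd _, by rw [dist_comm]; exact ht.2⟩

theorem mainTheorem7 {B : Type*} [NormedAddCommGroup B] [NormedSpace ℝ B] [CompleteSpace B]
    {Y : ℕ → Type*} [∀ n, NormedAddCommGroup (Y n)] [∀ n, NormedSpace ℝ (Y n)]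
    [∀ n, CompleteSpace (Y n)]
    {E : Type*} [AddCommGroup E] [Module ℝ E]
    (ι : B →ₗ[ℝ] E) (hι : Function.Injective ι)
    (j : ∀ n, Y n →ₗ[ℝ] E) (hj : ∀ n, Function.Injective (j n))
    (M : ℕ → SeminormedCone B)
    (hcont : ∀ n, (M n).ContinuouslyEmbedded)
    (hcompact : CompactAlong M id)
    (hcompat : ∀ ν : ℕ → ℕ, StrictMono ν → CompatibleAlong M ι j ν)
    (p : ℝ≥0∞) [Fact (1 ≤ p)] (T : ℝ) (hT : 0 < T)
    (u : ℕ → ℝ → B)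
    (hu : ∀ n, MemLpCone (M n) ι (j n) p T (u n))
    (hbound : ∃ C : ℝ≥0, ∀ n,
      eLpNorm (fun t => (M n).semi (u n t)) p (volume.restrict (Ioo 0 T)) ≤ C)
    (hshift : Tendsto (fun h : ℝ => ⨆ n, shiftNorm ι (j n) p T (u n) h) (𝓝[>] 0) (𝓝 0)) :
    (∃ hLp : ∀ n, MemLp (u n) p (volume.restrict (Ioo 0 T)),
      IsCompact (closure (range fun n => (hLp n).toLp (u n)))) ∧
    (p = ∞ → (∀ n, CompactAlong M fun _ => n) → (∀ n, CompatibleAlong M ι j fun _ => n) →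
      ∃ U : ℕ → C(Icc (0 : ℝ) T, B),
        (∀ n, ∀ᵐ t ∂(volume.restrict (Ioo 0 T)), ∀ ht : t ∈ Icc 0 T, u n t = U n ⟨t, ht⟩) ∧
        IsCompact (closure (range U))) := by
  have hp : 1 ≤ p := Fact.out
  obtain ⟨C, hC⟩ := hbound
  have hne := fun n => (hu n).nonempty hT
  have hLp := fun n => (hu n).memLp (hcont n)
  have hcpt := isCompact_closure_range_toLp hcompact hne hT hLp (fun n => (hu n).mem_cone)
    (fun n => (hu n).memLp_semi.1) hC fun ε hε => exists_shift_le hj hp hu hC hshift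
      (fun η hη => exists_ehrlingWith_eventually M ι j hj
        (fun ν hν => hcompact.comp_strictMono hne hν) hcompat hη) hε
  refine ⟨⟨hLp, hcpt⟩, fun hp' hcompactn hcompatn => ?_⟩
  subst hp'
  have hrep := fun n => exists_continuous_representative hT (hLp n).1 fun ε hε => by
    -- The bound for large n says nothing about a given n; the filter `pure n` invokes the
    -- inequality for that cone alone.
    obtain ⟨δ, hδ, h⟩ := exists_shift_le (l := pure n) hj hp hu hC hshift
      (fun η hη => exists_ehrlingWith M ι j hj n (hcompactn n) (hcompatn n) hη) hε
    exact ⟨δ, hδ, h⟩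
  choose U hU using hrep
  refine ⟨U, hU, isCompact_closure_range_of_net fun ε hε => ?_⟩
  exact exists_finite_net_of_totallyBounded U (fun n => (hLp n).toLp (u n))
    (hcpt.totallyBounded.subset subset_closure) hε hε 0 fun n m _ _ h =>
      (dist_continuousMap_le_dist_toLp hT (hLp n) (hLp m) (hU n) (hU m)).trans_lt h
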